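/- Let $m\ge 1$ be an integer, $\delta>0$, $\mathcal B=[-\delta,\delta]$, and let $f\in\mathcal C^{2m+1}(\mathcal B)$ be a real function with a $2m$-fold root at $0$, i.e. $f^{(j)}(0)=0$ for $0\le j<2m$ and $f^{(2m)}(0)\ne 0$. Put $h_{2m}(k)=\dfrac{1-k^{2m-1}}{1-k^{2m}}$ and $p_{2m}(k)=k^{2m}+k^{2m-1}-1$. The polynomial $p_{2m}$ has exactly two real roots, one in $(0,1)$; let $c_{2m,1}$ be the other one (it lies in $(-2,-1)$). Let $c_{2m,2}$ be the unique solution of $p_{2m}(k)-1=0$ in $[-2,c_{2m,1})$. Let $\mathcal B_{k,2m}=(c_{2m,2},c_{2m,1})\cup(c_{2m,1},-1)$. Given $k_0\in\mathbb R$, let $\tilde k_0=k_0$ and $\tilde k_{n+1}=h_{2m}(\tilde k_n)$, as long as $\tilde k_n\in\mathcal B_{k,2m}$. Suppose that the first term $\tilde k_\ell$ ($\ell\ge 0$) with $\tilde k_\ell\notin\mathcal B_{k,2m}$ also satisfies $\tilde k_\ell\notin\{-1,0,1,c_{2m,1},c_{2m,2}\}$ (that there is a first such term is not a hypothesis: it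 always exists). Then there is $\varepsilon>0$ such that for every $e_0$ with $0<|e_0|<\varepsilon$ the secant iteration $$e_1=k_0e_0,\qquad e_{n+2}=e_{n+1}-f(e_{n+1})\,\frac{e_n-e_{n+1}}{f(e_n)-f(e_{n+1})}\quad(n\ge 0)$$ is well defined, with $e_n\in\mathcal B$, $e_n\ne 0$ and $f(e_n)\ne f(e_{n+1})$ for all $n\ge 0$, and $(e_n)$ converges Q-linearly to $0$: $e_n\to 0$ and $\lim_{n\to\infty}|e_{n+1}|/|e_n|=c$ for some $c\in(0,1)$. -/

import Mathlib

open Set Filter Topology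

noncomputable section

/-- The secant iteration `e (n+2) = e (n+1) - f (e (n+1)) * (e n - e (n+1)) / (f (e n) - f (e (n+1)))`
with starting values `e 0 = a` and `e 1 = b`.  (A step is meaningful only when
`f (e n) ≠ f (e (n+1))`.) -/
def secantSeq (f : ℝ → ℝ) (a b : ℝ) : ℕ → ℝ
  | 0 => a
  | 1 => b
  | n + 2 =>
      secantSeq f a b (n + 1) -
        f (secantSeq f a b (n + 1)) *
          ((secantSeq f a b n - secantSeq f a b (n + 1)) /
            (f (secantSeq f a b n) - f (secantSeq f a b (n + 1))))

/-- Q-linear convergence of `x` to `L`: the sequence converges to `L` and the quotients of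
consecutive errors converge to an asymptotic error constant strictly between `0` and `1`. -/
def QLinearlyConvergesTo (x : ℕ → ℝ) (L : ℝ) : Prop :=
  Tendsto x atTop (𝓝 L) ∧
    ∃ c : ℝ, 0 < c ∧ c < 1 ∧
      Tendsto (fun n => |x (n + 1) - L| / |x n - L|) atTop (𝓝 c)

/-- `f` has an `m`-fold root at `0`, as a function on the set `s`. -/
def HasFoldRootAtZero (f : ℝ → ℝ) (s : Set ℝ) (m : ℕ) : Prop :=
  (∀ j < m, iteratedDerivWithin j f s 0 = 0) ∧ iteratedDerivWithin m f s 0 ≠ 0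

/-- The map `h_m(k) = (1 - k^(m-1)) / (1 - k^m)`. -/
def ratioMap (m : ℕ) (k : ℝ) : ℝ := (1 - k ^ (m - 1)) / (1 - k ^ m)

/-- The model ratios: `k̃ 0 = k₀` and `k̃ (n+1) = h_{2m} (k̃ n)`. -/
def modelRatio (m : ℕ) (k₀ : ℝ) : ℕ → ℝ
  | 0 => k₀
  | n + 1 => ratioMap (2 * m) (modelRatio m k₀ n)

/-- The characteristic function `p_m(k) = k^m + k^(m-1) - 1`. -/
def charP (m : ℕ) (k : ℝ) : ℝ := k ^ m + k ^ (m - 1) - 1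

/-- The characteristic function `q_m(k) = p_m(k) - 1`. -/
def charQ (m : ℕ) (k : ℝ) : ℝ := charP m k - 1

theorem charP_neg {m : ℕ} (hm : 1 ≤ m) (x : ℝ) :
    charP (2 * m) (-x) = x ^ (2 * m - 1) * (x - 1) - 1 := by
  obtain ⟨j, rfl⟩ : ∃ j, m = j + 1 := ⟨m - 1, by omega⟩
  have h1 : 2 * (j + 1) - 1 = 2 * j + 1 := by omega
  have h2 : 2 * (j + 1) = 2 * j + 1 + 1 := by omega
  have he : Even (2 * j) := even_two_mul j
  unfold charP
  rw [h1, h2, pow_succ, pow_succ, he.neg_pow]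
  ring

theorem continuous_charP (m : ℕ) : Continuous (charP m) := by
  unfold charP; fun_prop

theorem charP_strictAnti {m : ℕ} (hm : 1 ≤ m) : StrictAntiOn (charP (2 * m)) (Iic (-1)) := by
  intro a ha b hb hab
  rw [mem_Iic] at ha hb
  rw [← neg_neg a, ← neg_neg b, charP_neg hm, charP_neg hm]
  have hpow : (-b) ^ (2 * m - 1) ≤ (-a) ^ (2 * m - 1) :=
    pow_le_pow_left₀ (by linarith) (by linarith) _
  have hpos : 0 < (-a) ^ (2 * m - 1) := pow_pos (by linarith) _
  nlinarith [mul_le_mul_of_nonneg_right hpow (show (0 : ℝ) ≤ -b - 1 by linarith)]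

theorem charP_neg_one {m : ℕ} (hm : 1 ≤ m) : charP (2 * m) (-1) = -1 := by
  rw [charP_neg hm]; ring

theorem one_le_charP_neg_two {m : ℕ} (hm : 1 ≤ m) : 1 ≤ charP (2 * m) (-2) := by
  rw [charP_neg hm]
  have : (2 : ℝ) ^ 1 ≤ 2 ^ (2 * m - 1) := pow_le_pow_right₀ (by norm_num) (by omega)
  linarith

theorem root_charP_mem {m : ℕ} (hm : 1 ≤ m) {c : ℝ} (hc : charP (2 * m) c = 0)
    (hc' : c ∉ Ioo (0 : ℝ) 1) : c < -1 := by
  by_contra! hlt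
  rcases le_total 0 c with h0 | h0
  · rcases h0.eq_or_lt with rfl | h0
    · have h1 : 2 * m ≠ 0 := by omega
      have h2 : 2 * m - 1 ≠ 0 := by omega
      simp [charP, h1, h2] at hc
    · have h1 : 1 ≤ c := by
        by_contra! h
        exact hc' ⟨h0, h⟩
      have h2 := one_le_pow₀ (n := 2 * m) h1
      have h3 := one_le_pow₀ (n := 2 * m - 1) h1
      unfold charP at hc
      linarith
  · rw [← neg_neg c, charP_neg hm] at hc
    have h1 : 0 ≤ (-c) ^ (2 * m - 1) := pow_nonneg (by linarith) _
    nlinarith [mul_nonneg h1 (show (0 : ℝ) ≤ 1 - -c by linarith)]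

/-- Apart from its root in `(0, 1)`, the function `p_{2m}` has exactly one real root. -/
theorem existsUnique_charRootOne {m : ℕ} (hm : 1 ≤ m) :
    ∃! c : ℝ, charP (2 * m) c = 0 ∧ c ∉ Ioo (0 : ℝ) 1 := by
  have h := intermediate_value_Icc' (show (-2 : ℝ) ≤ -1 by norm_num)
    (continuous_charP (2 * m)).continuousOn
  obtain ⟨c, hc, hc0⟩ := h (show (0 : ℝ) ∈ Icc _ _ from
    ⟨by rw [charP_neg_one hm]; norm_num, by linarith [one_le_charP_neg_two hm]⟩)
  refine ⟨c, ⟨hc0, fun h => by linarith [h.1, hc.2]⟩, ?_⟩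
  rintro d ⟨hd0, hd⟩
  exact (charP_strictAnti hm).injOn (root_charP_mem hm hd0 hd).le hc.2 (hd0.trans hc0.symm)

/-- The constant `c_{2m,1}`: the real root of `p_{2m}` other than the one in `(0, 1)`. -/
def charRootOne (m : ℕ) (hm : 1 ≤ m) : ℝ := (existsUnique_charRootOne hm).choose

theorem charRootOne_spec {m : ℕ} (hm : 1 ≤ m) :
    charP (2 * m) (charRootOne m hm) = 0 ∧ charRootOne m hm ∉ Ioo (0 : ℝ) 1 :=
  (existsUnique_charRootOne hm).choose_spec.1

theorem charRootOne_mem {m : ℕ} (hm : 1 ≤ m) : charRootOne m hm ∈ Ioo (-2 : ℝ) (-1) := by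
  obtain ⟨h0, h1⟩ := charRootOne_spec hm
  have hlt := root_charP_mem hm h0 h1
  refine ⟨?_, hlt⟩
  by_contra! hle
  have := (charP_strictAnti hm).antitoneOn hlt.le (show (-2 : ℝ) ≤ -1 by norm_num) hle
  linarith [one_le_charP_neg_two hm]

/-- `q_{2m}` has exactly one root in `[-2, c_{2m,1})`. -/
theorem existsUnique_charRootTwo {m : ℕ} (hm : 1 ≤ m) :
    ∃! c : ℝ, c ∈ Ico (-2 : ℝ) (charRootOne m hm) ∧ charQ (2 * m) c = 0 := by
  have hc1 := charRootOne_mem hm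
  have h0 := (charRootOne_spec hm).1
  have h := intermediate_value_Icc' hc1.1.le (continuous_charP (2 * m)).continuousOn
  obtain ⟨c, hc, hcv⟩ := h (show (1 : ℝ) ∈ Icc _ _ from
    ⟨by rw [h0]; norm_num, one_le_charP_neg_two hm⟩)
  have hne : c ≠ charRootOne m hm := by
    rintro rfl
    rw [h0] at hcv
    norm_num at hcv
  refine ⟨c, ⟨⟨hc.1, lt_of_le_of_ne hc.2 hne⟩, by simp [charQ, hcv]⟩, ?_⟩
  rintro d ⟨hd, hd0⟩
  have hdv : charP (2 * m) d = 1 := by unfold charQ at hd0; linarith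
  exact (charP_strictAnti hm).injOn (hd.2.le.trans hc1.2.le) (hc.2.trans hc1.2.le)
    (hdv.trans hcv.symm)

/-- The constant `c_{2m,2}`: the unique root of `q_{2m}` in `[-2, c_{2m,1})`. -/
def charRootTwo (m : ℕ) (hm : 1 ≤ m) : ℝ := (existsUnique_charRootTwo hm).choose

theorem charRootTwo_spec {m : ℕ} (hm : 1 ≤ m) :
    charRootTwo m hm ∈ Ico (-2 : ℝ) (charRootOne m hm) ∧ charQ (2 * m) (charRootTwo m hm) = 0 :=
  (existsUnique_charRootTwo hm).choose_spec.1

/-- The set `B_{k,2m} = (c_{2m,2}, c_{2m,1}) ∪ (c_{2m,1}, -1)`. -/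
def ratioSet (m : ℕ) (hm : 1 ≤ m) : Set ℝ :=
  Ioo (charRootTwo m hm) (charRootOne m hm) ∪ Ioo (charRootOne m hm) (-1)

end

noncomputable section

/-! ### The ratio map on `(0, 1)` -/

/-! Write `f x = x ^ n * g x` with `n = 2 * m`, `g` continuous at `0` and `g 0 ≠ 0`. In terms of an
error `e` and the ratio `k` of the next error to it, the secant method becomes the map `ratioStep`,
which at `e = 0` reduces to `k ↦ h_n(k)` and is continuous at `(0, k)` whenever `k ^ n ≠ 1`. For
small `e₀` any fixed number of true ratios therefore stays close to the model ratios.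

The model ratios leave `B_{k,2m}`, because their oscillation about the fixed point `c_{2m,1}` grows
(`false_of_bounded_orbit`). Off the exceptional points they then move through `(-∞, c_{2m,2})`,
`(-1, 0)`, `(1, ∞)` into `(0, 1)`, entering this chain at any stage. On `(0, 1)` the map `h_n` is
antitone and sends some `[1/4, r]` with `r < 1` into its interior, so by compactness the true ratios
are trapped there too (`exists_trapping`). The errors then decay geometrically, the ratios become an
asymptotic orbit of `h_n`, and the absence of proper `2`-cycles forces convergence
(`exists_tendsto_of_antitoneOn`). -/

theorem ratioMap_eq_geom_sum (n : ℕ) {k : ℝ} (hk : k ≠ 1) :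
    ratioMap (n + 1) k =
      (∑ i ∈ Finset.range n, k ^ i) / (1 + k * ∑ i ∈ Finset.range n, k ^ i) := by
  have h1 : k - 1 ≠ 0 := sub_ne_zero.2 hk
  have e1 := mul_neg_geom_sum k n
  have e2 := mul_neg_geom_sum k (n + 1)
  rw [geom_sum_succ] at e2
  have h2 : (1 - k) ≠ 0 := sub_ne_zero.2 hk.symm
  rw [ratioMap, Nat.add_sub_cancel, ← e1, ← e2, mul_div_mul_left _ _ h2, add_comm]

theorem one_le_geom_sum {n : ℕ} (hn : 1 ≤ n) {k : ℝ} (hk : 0 ≤ k) :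
    1 ≤ ∑ i ∈ Finset.range n, k ^ i := by
  simpa using Finset.single_le_sum (f := fun i => k ^ i) (fun i _ => pow_nonneg hk i)
    (Finset.mem_range.2 hn)

/-- With `S k = ∑ i < n, k ^ i`, cross-multiplication leaves `S y - S x ≤ (y - x) * S x * S y`. This
is `key`, a termwise comparison, once `x ^ n` and `y ^ n` are expressed through the geometric sums.
-/
theorem ratioMap_antitoneOn (n : ℕ) : AntitoneOn (ratioMap (n + 1)) (Ioo 0 1) := by
  intro x hx y hy hxy
  rw [ratioMap_eq_geom_sum n hx.2.ne, ratioMap_eq_geom_sum n hy.2.ne]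
  have hA : 0 ≤ ∑ i ∈ Finset.range n, x ^ i := Finset.sum_nonneg fun i _ => pow_nonneg hx.1.le i
  have hB : 0 ≤ ∑ i ∈ Finset.range n, y ^ i := Finset.sum_nonneg fun i _ => pow_nonneg hy.1.le i
  have key : x ^ n * ∑ i ∈ Finset.range n, y ^ i ≤ y ^ n * ∑ i ∈ Finset.range n, x ^ i := by
    rw [Finset.mul_sum, Finset.mul_sum]
    refine Finset.sum_le_sum fun i hi => ?_
    obtain ⟨d, rfl⟩ := Nat.exists_eq_add_of_le (Finset.mem_range.1 hi).le
    rw [pow_add, pow_add]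
    have h1 : x ^ d ≤ y ^ d := pow_le_pow_left₀ hx.1.le hxy d
    have h2 : 0 ≤ x ^ i * y ^ i := mul_nonneg (pow_nonneg hx.1.le i) (pow_nonneg hy.1.le i)
    nlinarith [mul_le_mul_of_nonneg_left h1 h2]
  have e1 := mul_neg_geom_sum x n
  have e2 := mul_neg_geom_sum y n
  rw [div_le_div_iff₀ (by nlinarith [mul_nonneg hy.1.le hB]) (by nlinarith [mul_nonneg hx.1.le hA])]
  have e3 : x ^ n = 1 - (1 - x) * ∑ i ∈ Finset.range n, x ^ i := by linarith
  have e4 : y ^ n = 1 - (1 - y) * ∑ i ∈ Finset.range n, y ^ i := by linarith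
  rw [e3, e4] at key
  linarith

/-- This excludes proper `2`-cycles: with `A ≤ B` the geometric sums at `a ≤ b`, the hypotheses give
`b ≤ A * (1 - a * b) ≤ B * (1 - a * b) ≤ a`. -/
theorem ratioMap_eq_of_le_of_le {n : ℕ} {a b : ℝ} (ha : a ∈ Ioo (0 : ℝ) 1)
    (hb : b ∈ Ioo (0 : ℝ) 1) (hab : a ≤ b) (h1 : b ≤ ratioMap (n + 1) a)
    (h2 : ratioMap (n + 1) b ≤ a) : a = b := by
  rw [ratioMap_eq_geom_sum n ha.2.ne] at h1
  rw [ratioMap_eq_geom_sum n hb.2.ne] at h2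
  have hAB : ∑ i ∈ Finset.range n, a ^ i ≤ ∑ i ∈ Finset.range n, b ^ i :=
    Finset.sum_le_sum fun i _ => pow_le_pow_left₀ ha.1.le hab i
  have hA : 0 ≤ ∑ i ∈ Finset.range n, a ^ i := Finset.sum_nonneg fun i _ => pow_nonneg ha.1.le i
  have hB := hA.trans hAB
  rw [le_div_iff₀ (by nlinarith [mul_nonneg ha.1.le hA])] at h1
  rw [div_le_iff₀ (by nlinarith [mul_nonneg hb.1.le hB])] at h2
  have hab1 : 0 ≤ 1 - a * b := by nlinarith [ha.1, ha.2, hb.1, hb.2]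
  nlinarith [mul_nonneg hab1 (sub_nonneg.2 hAB)]

theorem half_le_ratioMap {n : ℕ} (hn : 1 ≤ n) {k : ℝ} (hk : k ∈ Ioo (0 : ℝ) 1) :
    1 / 2 ≤ ratioMap (n + 1) k := by
  rw [ratioMap_eq_geom_sum n hk.2.ne]
  have hA := one_le_geom_sum hn hk.1.le
  have e := mul_neg_geom_sum k n
  have hp1 : k ^ n ≤ 1 := pow_le_one₀ hk.1.le hk.2.le
  rw [le_div_iff₀ (by nlinarith [mul_nonneg hk.1.le (zero_le_one.trans hA)])]
  linarith

theorem ratioMap_lt_one {n : ℕ} {k : ℝ} (hk : k ∈ Ioo (0 : ℝ) 1) :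
    ratioMap (n + 1) k < 1 := by
  have h1 : k ^ (n + 1) < 1 := pow_lt_one₀ hk.1.le hk.2 (by omega)
  have h2 : k ^ (n + 1) < k ^ n := pow_lt_pow_right_of_lt_one₀ hk.1 hk.2 (by omega)
  rw [ratioMap, Nat.add_sub_cancel, div_lt_one (by linarith)]
  linarith

theorem continuousAt_ratioMap {N : ℕ} {k : ℝ} (hk : k ^ N ≠ 1) :
    ContinuousAt (ratioMap N) k := by
  unfold ratioMap
  exact ContinuousAt.div (by fun_prop) (by fun_prop) (sub_ne_zero.2 hk.symm)

/-! ### Convergence of asymptotic orbits of an antitone map -/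

/-- An asymptotic orbit of a continuous antitone map on `[p, r]` without proper `2`-cycles
converges. -/
theorem exists_tendsto_of_antitoneOn {h : ℝ → ℝ} {p r : ℝ} (hanti : AntitoneOn h (Icc p r))
    (hcont : ContinuousOn h (Icc p r))
    (hcyc : ∀ a ∈ Icc p r, ∀ b ∈ Icc p r, a ≤ b → b ≤ h a → h b ≤ a → a = b)
    {u : ℕ → ℝ} (hu : ∀ n, u n ∈ Icc p r)
    (hlim : Tendsto (fun n => u (n + 1) - h (u n)) atTop (𝓝 0)) :
    ∃ c ∈ Icc p r, Tendsto u atTop (𝓝 c) := by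
  have hpr : p ≤ r := (hu 0).1.trans (hu 0).2
  -- Constant extension allows evaluation just below the liminf and just above the limsup, which may
  -- be end points.
  set H : ℝ → ℝ := IccExtend hpr ((Icc p r).domRestrict h) with hH
  have hHeq : ∀ x ∈ Icc p r, H x = h x := fun x hx => by
    rw [hH, IccExtend_of_mem _ _ hx, domRestrict_apply]
  have hHanti : Antitone H := fun x y hxy =>
    hanti (projIcc p r hpr x).2 (projIcc p r hpr y).2 (monotone_projIcc hpr hxy)
  have hHcont : Continuous H := (continuousOn_iff_continuous_domRestrict.1 hcont).Icc_extend'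
  have hba : BddAbove (range u) := ⟨r, by rintro _ ⟨n, rfl⟩; exact (hu n).2⟩
  have hbb : BddBelow (range u) := ⟨p, by rintro _ ⟨n, rfl⟩; exact (hu n).1⟩
  have hba' : IsBoundedUnder (· ≤ ·) atTop u := hba.isBoundedUnder_of_range
  have hbb' : IsBoundedUnder (· ≥ ·) atTop u := hbb.isBoundedUnder_of_range
  set a := liminf u atTop with ha
  set b := limsup u atTop with hb
  have hab : a ≤ b := liminf_le_limsup hba' hbb'
  have hpa : p ≤ a := le_liminf_of_le hba'.isCoboundedUnder_ge (Eventually.of_forall fun n => (hu n).1)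
  have hbr : b ≤ r := limsup_le_of_le hbb'.isCoboundedUnder_le (Eventually.of_forall fun n => (hu n).2)
  have hmemA : a ∈ Icc p r := ⟨hpa, hab.trans hbr⟩
  have hmemB : b ∈ Icc p r := ⟨hpa.trans hab, hbr⟩
  have hlim' : ∀ ε > 0, ∀ᶠ n in atTop, |u (n + 1) - H (u n)| < ε := fun ε hε => by
    filter_upwards [(tendsto_order.1 hlim.abs).2 ε (by simpa using hε)] with n hn
    rwa [hHeq _ (hu n)]
  -- Eventually `u n` exceeds any `x < a`, so `u (n + 1)` is nearly at most `H x`, which is close to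
  -- `H a`.
  have h1 : b ≤ H a := by
    refine le_of_forall_pos_le_add fun ε hε => ?_
    obtain ⟨x, hxa, hx⟩ : ∃ x < a, H x < H a + ε / 2 :=
      ((((hHcont.tendsto a).mono_left nhdsWithin_le_nhds).eventually
        (gt_mem_nhds (show H a < H a + ε / 2 by linarith))).and
        (self_mem_nhdsWithin (a := a) (s := Iio a))).exists.imp fun x hx => ⟨hx.2, hx.1⟩
    have hev : ∀ᶠ n in atTop, u (n + 1) ≤ H a + ε := by
      filter_upwards [eventually_lt_of_lt_liminf hxa hbb', hlim' (ε / 2) (by positivity)] with n h1 h2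
      have := hHanti h1.le
      linarith [(abs_lt.1 h2).2]
    refine limsup_le_of_le hbb'.isCoboundedUnder_le ?_
    rw [← map_add_atTop_eq_nat 1]
    exact eventually_map.2 hev
  have h2 : H b ≤ a := by
    refine le_of_forall_pos_le_add fun ε hε => ?_
    obtain ⟨x, hxb, hx⟩ : ∃ x > b, H b - ε / 2 < H x :=
      ((((hHcont.tendsto b).mono_left nhdsWithin_le_nhds).eventually
        (lt_mem_nhds (show H b - ε / 2 < H b by linarith))).and
        (self_mem_nhdsWithin (a := b) (s := Ioi b))).exists.imp fun x hx => ⟨hx.2, hx.1⟩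
    have hev : ∀ᶠ n in atTop, H b - ε ≤ u (n + 1) := by
      filter_upwards [eventually_lt_of_limsup_lt hxb hba', hlim' (ε / 2) (by positivity)] with n h1 h2
      have := hHanti h1.le
      linarith [(abs_lt.1 h2).1]
    have : H b - ε ≤ a := by
      refine le_liminf_of_le hba'.isCoboundedUnder_ge ?_
      rw [← map_add_atTop_eq_nat 1]
      exact eventually_map.2 hev
    linarith
  have heq : a = b := hcyc a hmemA b hmemB hab (by rwa [← hHeq a hmemA]) (by rwa [← hHeq b hmemB])
  exact ⟨a, hmemA, tendsto_of_liminf_eq_limsup rfl heq.symm hba' hbb'⟩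

/-! ### The orbit of the model ratios -/

theorem ratioMap_mul_sub_one {m : ℕ} (hm : 1 ≤ m) {x y : ℝ} (hx : 1 < x)
    (h : ratioMap (2 * m) (-x) = -y) : x ^ (2 * m - 1) * (x * y - 1) = 1 + y := by
  have h1 : 1 < x ^ (2 * m) := one_lt_pow₀ hx (by omega)
  have ho : Odd (2 * m - 1) := ⟨m - 1, by omega⟩
  rw [ratioMap, ho.neg_pow, (even_two_mul m).neg_pow, div_eq_iff (by linarith)] at h
  have h2 : x ^ (2 * m) = x ^ (2 * m - 1) * x := by
    rw [← pow_succ]; congr 1; omega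
  rw [h2] at h
  linarith

/-- Oscillations grow: for an orbit `t, s, u` with `s < t`, assuming `u ≤ t` gives `1 + t ≤ s ^ M *
(t * s - 1) ≤ t ^ M * (t * s - 1) = 1 + s`. -/
theorem lt_of_mul_sub_one_eq {M : ℕ} {s t u : ℝ} (hs : 1 < s) (ht : 1 < t) (hst : s < t)
    (h1 : t ^ M * (t * s - 1) = 1 + s) (h2 : s ^ M * (s * u - 1) = 1 + u) : t < u := by
  by_contra! hut
  have hM : s ^ M ≤ t ^ M := pow_le_pow_left₀ (by linarith) hst.le M
  have hp : 1 ≤ s ^ M := one_le_pow₀ hs.le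
  have hts : 0 < t * s - 1 := by nlinarith
  have h3 : s ^ M * (t * s - 1) ≤ t ^ M * (t * s - 1) := mul_le_mul_of_nonneg_right hM hts.le
  have h4 : 1 < s ^ M * s := by nlinarith
  nlinarith [mul_le_mul_of_nonneg_right hut (sub_nonneg.2 h4.le)]

theorem lt_of_mul_sub_one_eq' {M : ℕ} {s t u : ℝ} (hs : 1 < s) (ht : 1 < t) (hst : t < s)
    (h1 : t ^ M * (t * s - 1) = 1 + s) (h2 : s ^ M * (s * u - 1) = 1 + u) : u < t := by
  by_contra! hut
  have hM : t ^ M ≤ s ^ M := pow_le_pow_left₀ (by linarith) hst.le M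
  have hp : 1 ≤ s ^ M := one_le_pow₀ hs.le
  have hts : 0 < t * s - 1 := by nlinarith
  have h3 : t ^ M * (t * s - 1) ≤ s ^ M * (t * s - 1) := mul_le_mul_of_nonneg_right hM hts.le
  have h4 : 1 < s ^ M * s := by nlinarith
  nlinarith [mul_le_mul_of_nonneg_right hut (sub_nonneg.2 h4.le)]

/-- The correspondence `t ^ M * (t * s - 1) = 1 + s` has no bounded orbit in `(1, ∞)` that starts
with a descent. -/
theorem false_of_bounded_orbit {M : ℕ} {x : ℕ → ℝ} {B : ℝ} (hx : ∀ n, 1 < x n)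
    (hB : ∀ n, x n ≤ B) (hrel : ∀ n, x n ^ M * (x n * x (n + 1) - 1) = 1 + x (n + 1))
    (h0 : x 1 < x 0) : False := by
  have hlt : ∀ i, x (2 * i + 1) < x (2 * i) := by
    intro i
    induction i with
    | zero => exact h0
    | succ i ih =>
      have h1 : x (2 * i) < x (2 * i + 2) :=
        lt_of_mul_sub_one_eq (hx _) (hx _) ih (hrel _) (hrel _)
      have h2 : x (2 * i + 3) < x (2 * i + 1) :=
        lt_of_mul_sub_one_eq' (hx _) (hx _) (ih.trans h1) (hrel _) (hrel _)
      exact (h2.trans ih).trans h1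
  have hup : ∀ i, x (2 * i) < x (2 * i + 2) := fun i =>
    lt_of_mul_sub_one_eq (hx _) (hx _) (hlt i) (hrel _) (hrel _)
  have hdown : ∀ i, x (2 * i + 3) < x (2 * i + 1) := fun i =>
    lt_of_mul_sub_one_eq' (hx _) (hx _) ((hlt i).trans (hup i)) (hrel _) (hrel _)
  have hmono : Monotone fun i => x (2 * i) := monotone_nat_of_le_succ fun i => (hup i).le
  have hanti : Antitone fun i => x (2 * i + 1) := antitone_nat_of_succ_le fun i => (hdown i).le
  have hL := tendsto_atTop_ciSup hmono ⟨B, by rintro _ ⟨n, rfl⟩; exact hB _⟩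
  have hS := tendsto_atTop_ciInf hanti ⟨1, by rintro _ ⟨n, rfl⟩; exact (hx _).le⟩
  set L := ⨆ i, x (2 * i)
  set S := ⨅ i, x (2 * i + 1)
  have hS1 : 1 ≤ S := ge_of_tendsto' hS fun i => (hx _).le
  have hSL : S < L := (hanti.le_of_tendsto hS 0).trans_lt
    ((hlt 0).trans_le (hmono.ge_of_tendsto hL 0))
  have hL' : Tendsto (fun i => x (2 * i + 2)) atTop (𝓝 L) := hL.comp (tendsto_add_atTop_nat 1)
  have e1 : L ^ M * (L * S - 1) = 1 + S :=
    tendsto_nhds_unique (((hL.pow M).mul ((hL.mul hS).sub_const 1)).congr fun i => hrel (2 * i))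
      (hS.const_add 1)
  have e2 : S ^ M * (S * L - 1) = 1 + L :=
    tendsto_nhds_unique
      (((hS.pow M).mul ((hS.mul hL').sub_const 1)).congr fun i => hrel (2 * i + 1))
      (hL'.const_add 1)
  -- The limits form a `2`-cycle with `S < L`, but comparing `e1` with `e2` gives `1 + L ≤ 1 + S`.
  have hM : S ^ M ≤ L ^ M := pow_le_pow_left₀ (by linarith) hSL.le M
  nlinarith [mul_le_mul_of_nonneg_right hM (show 0 ≤ L * S - 1 by nlinarith)]

theorem charRootTwo_lt_charRootOne {m : ℕ} (hm : 1 ≤ m) :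
    charRootTwo m hm < charRootOne m hm := (charRootTwo_spec hm).1.2

theorem lt_neg_one_of_mem_ratioSet {m : ℕ} {hm : 1 ≤ m} {k : ℝ} (hk : k ∈ ratioSet m hm) :
    k < -1 := by
  rcases hk with hk | hk
  · exact hk.2.trans (charRootOne_mem hm).2
  · exact hk.2

theorem neg_two_lt_of_mem_ratioSet {m : ℕ} {hm : 1 ≤ m} {k : ℝ} (hk : k ∈ ratioSet m hm) :
    -2 < k := by
  rcases hk with hk | hk
  · exact (charRootTwo_spec hm).1.1.trans_lt hk.1
  · exact (charRootOne_mem hm).1.trans hk.1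

theorem ne_charRootOne_of_mem_ratioSet {m : ℕ} {hm : 1 ≤ m} {k : ℝ} (hk : k ∈ ratioSet m hm) :
    k ≠ charRootOne m hm := by
  rcases hk with hk | hk
  · exact hk.2.ne
  · exact hk.1.ne'

theorem eq_charRootOne_of_ratioMap_eq {m : ℕ} (hm : 1 ≤ m) {k : ℝ} (hk : k < -1)
    (h : ratioMap (2 * m) k = k) : k = charRootOne m hm := by
  have h1 := ratioMap_mul_sub_one hm (x := -k) (y := -k) (by linarith) (by simpa using h)
  have hz : charP (2 * m) k = 0 := by
    rw [← neg_neg k, charP_neg hm]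
    -- The fixed-point equation factors into `1 - k`, nonzero here, and `charP (2 * m) k`.
    have : (1 + -k) * ((-k) ^ (2 * m - 1) * (-k - 1) - 1) = 0 := by linarith
    exact (mul_eq_zero.1 this).resolve_left (by linarith)
  exact (existsUnique_charRootOne hm).unique ⟨hz, fun h => by linarith [h.1]⟩ (charRootOne_spec hm)

/-- The model ratios always leave `B_{k,2m}`. -/
theorem exists_modelRatio_notMem_ratioSet {m : ℕ} (hm : 1 ≤ m) (k₀ : ℝ) :
    ∃ n, modelRatio m k₀ n ∉ ratioSet m hm := by
  by_contra! hall
  set x : ℕ → ℝ := fun n => -modelRatio m k₀ n with hxdef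
  have hx : ∀ n, 1 < x n := fun n => by
    have := lt_neg_one_of_mem_ratioSet (hall n)
    simp only [hxdef]; linarith
  have hB : ∀ n, x n ≤ 2 := fun n => by
    have := neg_two_lt_of_mem_ratioSet (hall n)
    simp only [hxdef]; linarith
  have hrel : ∀ n, x n ^ (2 * m - 1) * (x n * x (n + 1) - 1) = 1 + x (n + 1) := fun n =>
    ratioMap_mul_sub_one hm (hx n) (by simp [hxdef, modelRatio])
  rcases lt_trichotomy (x 1) (x 0) with h | h | h
  · exact false_of_bounded_orbit hx hB hrel h
  · refine ne_charRootOne_of_mem_ratioSet (hall 0)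
      (eq_charRootOne_of_ratioMap_eq hm (lt_neg_one_of_mem_ratioSet (hall 0)) ?_)
    simpa [hxdef, modelRatio] using h
  -- After an initial ascent `x 2 < x 0 < x 1`, so the shifted orbit starts with a descent.
  · exact false_of_bounded_orbit (x := fun n => x (n + 1)) (fun n => hx _) (fun n => hB _)
      (fun n => hrel _) ((lt_of_mul_sub_one_eq' (hx _) (hx _) h (hrel _) (hrel _)).trans h)

/-! ### Passage of the model ratios into `(0, 1)` -/

theorem ratioMap_mem_of_lt_charRootTwo {m : ℕ} (hm : 1 ≤ m) {k : ℝ} (hk : k < charRootTwo m hm) :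
    ratioMap (2 * m) k ∈ Ioo (-1 : ℝ) 0 := by
  have hc := (charRootTwo_lt_charRootOne hm).trans (charRootOne_mem hm).2
  have hP := charP_strictAnti hm (hk.trans hc).le hc.le hk
  have hQ := (charRootTwo_spec hm).2
  have hneg : k ^ (2 * m - 1) < 0 := Odd.pow_neg ⟨m - 1, by omega⟩ (by linarith)
  unfold charQ at hQ
  unfold charP at hP hQ
  have hd : 1 - k ^ (2 * m) < 0 := by linarith
  constructor
  -- As the denominator is negative, `-1 < h_{2m}(k)` amounts to `0 < charQ (2 * m) k`.
  · rw [ratioMap, lt_div_iff_of_neg hd]; linarith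
  · exact div_neg_of_pos_of_neg (by linarith) hd

theorem one_lt_ratioMap {m : ℕ} (hm : 1 ≤ m) {k : ℝ} (hk : k ∈ Ioo (-1 : ℝ) 0) :
    1 < ratioMap (2 * m) k := by
  have h1 : k ^ (2 * m) < 1 := by
    rw [← (even_two_mul m).neg_pow]
    exact pow_lt_one₀ (by linarith [hk.2]) (by linarith [hk.1]) (by omega)
  have h2 : k ^ (2 * m - 1) < 0 := Odd.pow_neg ⟨m - 1, by omega⟩ hk.2
  have h3 : 0 ≤ k ^ (2 * m) := (even_two_mul m).pow_nonneg k
  rw [ratioMap, lt_div_iff₀ (by linarith)]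
  linarith

theorem ratioMap_mem_of_one_lt {m : ℕ} (hm : 1 ≤ m) {k : ℝ} (hk : 1 < k) :
    ratioMap (2 * m) k ∈ Ioo (0 : ℝ) 1 := by
  have h1 : k ^ (2 * m - 1) < k ^ (2 * m) := pow_lt_pow_right₀ hk (by omega)
  have h2 : 1 < k ^ (2 * m - 1) := one_lt_pow₀ hk (by omega)
  constructor
  · exact div_pos_of_neg_of_neg (by linarith) (by linarith)
  · rw [ratioMap, div_lt_one_of_neg (by linarith)]; linarith

theorem pow_two_mul_ne_one {m : ℕ} (hm : 1 ≤ m) {k : ℝ} (h1 : k ≠ 1) (h2 : k ≠ -1) :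
    k ^ (2 * m) ≠ 1 := by
  intro h
  rcases pow_eq_one_iff_cases.1 h with h | h | h
  · omega
  · exact h1 h
  · exact h2 h.1

/-- The ratios outside the closure of `B_{k,2m}` other than `0` and `1`. -/
def IsAttractedRatio (m : ℕ) (hm : 1 ≤ m) (k : ℝ) : Prop :=
  k < charRootTwo m hm ∨ k ∈ Ioo (-1 : ℝ) 0 ∨ 1 < k ∨ k ∈ Ioo (0 : ℝ) 1

theorem ratioMap_mem_Ioo {m : ℕ} (hm : 1 ≤ m) {k : ℝ} (hk : k ∈ Ioo (0 : ℝ) 1) :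
    ratioMap (2 * m) k ∈ Ico (1 / 2 : ℝ) 1 := by
  obtain ⟨n, hn⟩ : ∃ n, 2 * m = n + 1 := ⟨2 * m - 1, by omega⟩
  rw [hn]
  exact ⟨half_le_ratioMap (by omega) hk, ratioMap_lt_one hk⟩

theorem IsAttractedRatio.ratioMap {m : ℕ} {hm : 1 ≤ m} {k : ℝ} (hk : IsAttractedRatio m hm k) :
    IsAttractedRatio m hm (ratioMap (2 * m) k) := by
  rcases hk with hk | hk | hk | hk
  · exact .inr (.inl (ratioMap_mem_of_lt_charRootTwo hm hk))
  · exact .inr (.inr (.inl (one_lt_ratioMap hm hk)))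
  · exact .inr (.inr (.inr (ratioMap_mem_of_one_lt hm hk)))
  · have := ratioMap_mem_Ioo hm hk
    exact .inr (.inr (.inr ⟨by linarith [this.1], this.2⟩))

theorem IsAttractedRatio.notMem {m : ℕ} {hm : 1 ≤ m} {k : ℝ} (hk : IsAttractedRatio m hm k) :
    k ∉ ({-1, 0, 1} : Set ℝ) := by
  have hc := (charRootTwo_lt_charRootOne hm).trans (charRootOne_mem hm).2
  simp only [mem_insert_iff, mem_singleton_iff]
  rcases hk with hk | hk | hk | hk
  · rintro (rfl | rfl | rfl) <;> linarith
  · rintro (rfl | rfl | rfl) <;> linarith [hk.1, hk.2]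
  · rintro (rfl | rfl | rfl) <;> linarith
  · rintro (rfl | rfl | rfl) <;> linarith [hk.1, hk.2]

theorem isAttractedRatio_of_notMem {m : ℕ} {hm : 1 ≤ m} {k : ℝ} (hk : k ∉ ratioSet m hm)
    (hk' : k ∉ ({-1, 0, 1, charRootOne m hm, charRootTwo m hm} : Set ℝ)) :
    IsAttractedRatio m hm k := by
  simp only [mem_insert_iff, mem_singleton_iff, not_or] at hk'
  obtain ⟨h1, h2, h3, h4, h5⟩ := hk'
  by_contra h
  simp only [IsAttractedRatio, not_or, not_lt, mem_Ioo, not_and] at h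
  obtain ⟨g1, g2, g3, g4⟩ := h
  refine hk ?_
  have hlt : charRootTwo m hm < k := lt_of_le_of_ne g1 (Ne.symm h5)
  have hk1 : k < -1 := by
    by_contra! hge
    have a1 : -1 < k := lt_of_le_of_ne hge (Ne.symm h1)
    have a2 : 0 < k := lt_of_le_of_ne (g2 a1) (Ne.symm h2)
    exact h3 (le_antisymm g3 (g4 a2))
  rcases lt_or_gt_of_ne h4 with h | h
  · exact .inl ⟨hlt, h⟩
  · exact .inr ⟨h, hk1⟩

theorem exists_isAttractedRatio {m : ℕ} {hm : 1 ≤ m} {k₀ : ℝ}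
    (hk : ∀ ℓ : ℕ, IsLeast {n : ℕ | modelRatio m k₀ n ∉ ratioSet m hm} ℓ →
      modelRatio m k₀ ℓ ∉ ({-1, 0, 1, charRootOne m hm, charRootTwo m hm} : Set ℝ)) :
    ∃ ℓ, (∀ n < ℓ, modelRatio m k₀ n ∈ ratioSet m hm) ∧
      ∀ n, ℓ ≤ n → IsAttractedRatio m hm (modelRatio m k₀ n) := by
  classical
  have hex := exists_modelRatio_notMem_ratioSet hm k₀
  have hleast : IsLeast {n : ℕ | modelRatio m k₀ n ∉ ratioSet m hm} (Nat.find hex) :=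
    ⟨Nat.find_spec hex, fun n hn => Nat.find_min' hex hn⟩
  refine ⟨Nat.find hex, fun n hn => not_not.1 (Nat.find_min hex hn), fun n hn => ?_⟩
  induction n, hn using Nat.le_induction with
  | base => exact isAttractedRatio_of_notMem hleast.1 (hk _ hleast)
  | succ n _ ih => exact ih.ratioMap

/-- At `±1` the denominator of `h_{2m}` vanishes, and a ratio `0` would produce a zero error; none
of these occurs along the orbit. -/
theorem modelRatio_notMem {m : ℕ} {hm : 1 ≤ m} {k₀ : ℝ}
    (hk : ∀ ℓ : ℕ, IsLeast {n : ℕ | modelRatio m k₀ n ∉ ratioSet m hm} ℓ →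
      modelRatio m k₀ ℓ ∉ ({-1, 0, 1, charRootOne m hm, charRootTwo m hm} : Set ℝ)) (n : ℕ) :
    modelRatio m k₀ n ∉ ({-1, 0, 1} : Set ℝ) := by
  obtain ⟨ℓ, h1, h2⟩ := exists_isAttractedRatio hk
  rcases lt_or_ge n ℓ with hn | hn
  · have := lt_neg_one_of_mem_ratioSet (h1 n hn)
    simp only [mem_insert_iff, mem_singleton_iff]
    rintro (h | h | h) <;> linarith
  · exact (h2 n hn).notMem

theorem exists_modelRatio_mem_Ioo {m : ℕ} {hm : 1 ≤ m} {k₀ : ℝ}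
    (hk : ∀ ℓ : ℕ, IsLeast {n : ℕ | modelRatio m k₀ n ∉ ratioSet m hm} ℓ →
      modelRatio m k₀ ℓ ∉ ({-1, 0, 1, charRootOne m hm, charRootTwo m hm} : Set ℝ)) :
    ∃ n, modelRatio m k₀ n ∈ Ioo (0 : ℝ) 1 := by
  obtain ⟨ℓ, -, h⟩ := exists_isAttractedRatio hk
  rcases h ℓ le_rfl with h | h | h | h
  · exact ⟨ℓ + 3, ratioMap_mem_of_one_lt hm (one_lt_ratioMap hm
      (ratioMap_mem_of_lt_charRootTwo hm h))⟩
  · exact ⟨ℓ + 2, ratioMap_mem_of_one_lt hm (one_lt_ratioMap hm h)⟩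
  · exact ⟨ℓ + 1, ratioMap_mem_of_one_lt hm h⟩
  · exact ⟨ℓ, h⟩

/-! ### The trapping interval -/

/-- The right end point of an interval `[1/4, r]` which `h_n` maps into its interior. -/
def trapBound (n : ℕ) : ℝ := (1 + ratioMap n (1 / 4)) / 2

theorem trapBound_lt_one {m : ℕ} (hm : 1 ≤ m) : trapBound (2 * m) < 1 := by
  have := (ratioMap_mem_Ioo hm (k := 1 / 4) ⟨by norm_num, by norm_num⟩).2
  unfold trapBound; linarith

theorem trap_subset {m : ℕ} (hm : 1 ≤ m) : Icc (1 / 4) (trapBound (2 * m)) ⊆ Ioo (0 : ℝ) 1 :=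
  fun _ hk => ⟨by linarith [hk.1], hk.2.trans_lt (trapBound_lt_one hm)⟩

/-- By antitonicity `1/2 ≤ h_{2m}(k) ≤ h_{2m}(1/4) < r`. The strict bounds leave room for
perturbation by a small error. -/
theorem ratioMap_mem_trap {m : ℕ} (hm : 1 ≤ m) {k : ℝ} (hk : 1 / 4 ≤ k) (hk1 : k < 1) :
    ratioMap (2 * m) k ∈ Ioo (1 / 4) (trapBound (2 * m)) := by
  have h4 : (1 / 4 : ℝ) ∈ Ioo (0 : ℝ) 1 := ⟨by norm_num, by norm_num⟩
  have hk0 : k ∈ Ioo (0 : ℝ) 1 := ⟨by linarith, hk1⟩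
  have h1 := (ratioMap_mem_Ioo hm h4).2
  refine ⟨by linarith [(ratioMap_mem_Ioo hm hk0).1], ?_⟩
  have h2 : ratioMap (2 * m) k ≤ ratioMap (2 * m) (1 / 4) := by
    obtain ⟨n, hn⟩ : ∃ n, 2 * m = n + 1 := ⟨2 * m - 1, by omega⟩
    rw [hn]
    exact ratioMap_antitoneOn n h4 hk0 hk
  unfold trapBound
  linarith

theorem exists_modelRatio_mem_trap {m : ℕ} {hm : 1 ≤ m} {k₀ : ℝ}
    (hk : ∀ ℓ : ℕ, IsLeast {n : ℕ | modelRatio m k₀ n ∉ ratioSet m hm} ℓ →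
      modelRatio m k₀ ℓ ∉ ({-1, 0, 1, charRootOne m hm, charRootTwo m hm} : Set ℝ)) :
    ∃ n, modelRatio m k₀ n ∈ Ioo (1 / 4) (trapBound (2 * m)) := by
  obtain ⟨n, hn⟩ := exists_modelRatio_mem_Ioo hk
  have h1 := ratioMap_mem_Ioo hm hn
  exact ⟨n + 2, ratioMap_mem_trap hm (k := modelRatio m k₀ (n + 1)) (by
    have : 1 / 2 ≤ modelRatio m k₀ (n + 1) := h1.1
    linarith) h1.2⟩

/-! ### The secant method in terms of an error and a ratio of errors -/

/-- Taylor's formula with Peano remainder: `f x / x ^ n` tends to the leading coefficient `a`, which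
is taken as the value of `g` at `0`. -/
theorem exists_eq_pow_mul {f : ℝ → ℝ} {δ : ℝ} (hδ : 0 < δ) {n : ℕ} (hn : n ≠ 0)
    (hf : ContDiffOn ℝ n f (Icc (-δ) δ)) (hroot : HasFoldRootAtZero f (Icc (-δ) δ) n) :
    ∃ g : ℝ → ℝ, ContinuousAt g 0 ∧ g 0 ≠ 0 ∧ ∀ x, f x = x ^ n * g x := by
  have hmem : (0 : ℝ) ∈ Icc (-δ) δ := ⟨by linarith, hδ.le⟩
  have ht := taylor_tendsto (convex_Icc (-δ) δ) hmem hf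
  rw [nhdsWithin_eq_nhds.2 (Icc_mem_nhds (by linarith) hδ)] at ht
  set a : ℝ := (n.factorial : ℝ)⁻¹ * iteratedDerivWithin n f (Icc (-δ) δ) 0 with ha
  have htay : ∀ x, taylorWithinEval f n (Icc (-δ) δ) 0 x = a * x ^ n := fun x => by
    rw [taylor_within_apply, Finset.sum_range_succ, Finset.sum_eq_zero, zero_add, sub_zero,
      smul_eq_mul, ha]
    · ring
    · intro j hj
      rw [hroot.1 j (Finset.mem_range.1 hj), smul_zero]
  refine ⟨Function.update (fun x => f x / x ^ n) 0 a, ?_, ?_, fun x => ?_⟩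
  · rw [continuousAt_update_same]
    have h2 := (ht.mono_left (nhdsWithin_le_nhds (s := {0}ᶜ))).add_const a
    rw [zero_add] at h2
    refine h2.congr' ?_
    filter_upwards [self_mem_nhdsWithin] with x hx
    have hx' : x ^ n ≠ 0 := pow_ne_zero n hx
    rw [htay, sub_zero, smul_eq_mul]
    field_simp
    ring
  · rw [Function.update_self]
    exact mul_ne_zero (by positivity) hroot.2
  · rcases eq_or_ne x 0 with rfl | hx
    · have := hroot.1 0 (Nat.pos_of_ne_zero hn)
      rw [iteratedDerivWithin_zero] at this
      rw [this, zero_pow hn, zero_mul]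
    · rw [Function.update_of_ne hx, mul_div_cancel₀ _ (pow_ne_zero n hx)]

/-- For `f x = x ^ n * g x`, the quantity with `f e - f (k * e) = e ^ n * ratioDenom g n (e, k)`. -/
def ratioDenom (g : ℝ → ℝ) (n : ℕ) (p : ℝ × ℝ) : ℝ := g p.1 - p.2 ^ n * g (p.2 * p.1)

/-- One secant step for `f x = x ^ n * g x` in terms of the error `e` and the ratio `k` of the next
error to `e`. -/
def ratioStep (g : ℝ → ℝ) (n : ℕ) (p : ℝ × ℝ) : ℝ × ℝ :=
  (p.2 * p.1, ratioDenom g (n - 1) p / ratioDenom g n p)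

theorem continuousAt_ratioDenom {g : ℝ → ℝ} (hg : ContinuousAt g 0) (n : ℕ) (k : ℝ) :
    ContinuousAt (ratioDenom g n) (0, k) := by
  have h1 : ContinuousAt (fun p : ℝ × ℝ => g p.1) (0, k) :=
    ContinuousAt.comp_of_eq hg continuousAt_fst rfl
  have h2 : ContinuousAt (fun p : ℝ × ℝ => g (p.2 * p.1)) (0, k) :=
    ContinuousAt.comp_of_eq hg (f := fun p : ℝ × ℝ => p.2 * p.1) (by fun_prop) (by simp)
  exact h1.sub ((continuousAt_snd.pow n).mul h2)

theorem ratioDenom_zero (g : ℝ → ℝ) (n : ℕ) (k : ℝ) :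
    ratioDenom g n (0, k) = (1 - k ^ n) * g 0 := by
  simp only [ratioDenom, mul_zero]; ring

theorem ratioDenom_zero_ne_zero {g : ℝ → ℝ} (h0 : g 0 ≠ 0) {n : ℕ} {k : ℝ} (hk : k ^ n ≠ 1) :
    ratioDenom g n (0, k) ≠ 0 := by
  rw [ratioDenom_zero]
  exact mul_ne_zero (sub_ne_zero.2 hk.symm) h0

theorem continuousAt_ratioStep {g : ℝ → ℝ} (hg : ContinuousAt g 0) (h0 : g 0 ≠ 0) {n : ℕ} {k : ℝ}
    (hk : k ^ n ≠ 1) : ContinuousAt (ratioStep g n) (0, k) :=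
  ContinuousAt.prodMk (by fun_prop) ((continuousAt_ratioDenom hg _ k).div
    (continuousAt_ratioDenom hg n k) (ratioDenom_zero_ne_zero h0 hk))

theorem ratioStep_zero {g : ℝ → ℝ} (h0 : g 0 ≠ 0) (n : ℕ) (k : ℝ) :
    ratioStep g n (0, k) = (0, ratioMap n k) := by
  simp only [ratioStep, ratioDenom_zero, mul_zero, ratioMap, mul_div_mul_right _ _ h0]

theorem sub_eq_pow_mul_ratioDenom {f g : ℝ → ℝ} {n : ℕ} (hfg : ∀ x, f x = x ^ n * g x)
    (p : ℝ × ℝ) : f p.1 - f (p.2 * p.1) = p.1 ^ n * ratioDenom g n p := by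
  rw [hfg, hfg, ratioDenom, mul_pow]; ring

/-- After the powers of `e` cancel, the new error is `k * e * (1 - k ^ (n - 1) * (1 - k) * g (k * e)
/ D_n)`, and the bracket equals `D_{n-1} / D_n`, where `D_i = ratioDenom g i (e, k)`. -/
theorem secant_step_eq {f g : ℝ → ℝ} {n : ℕ} (hn : 1 ≤ n) (hfg : ∀ x, f x = x ^ n * g x)
    {p : ℝ × ℝ} (h1 : p.1 ≠ 0) (hD : ratioDenom g n p ≠ 0) :
    p.2 * p.1 - f (p.2 * p.1) * ((p.1 - p.2 * p.1) / (f p.1 - f (p.2 * p.1))) =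
      (ratioStep g n p).2 * (ratioStep g n p).1 := by
  obtain ⟨j, rfl⟩ : ∃ j, n = j + 1 := ⟨n - 1, by omega⟩
  rw [sub_eq_pow_mul_ratioDenom hfg, hfg (p.2 * p.1), ratioStep, Nat.add_sub_cancel]
  have hj : ratioDenom g j p =
      ratioDenom g (j + 1) p - p.2 ^ j * (1 - p.2) * g (p.2 * p.1) := by
    simp only [ratioDenom]; ring
  rw [hj]
  field_simp
  ring

/-- The pairs of an error in `[-δ, δ]` and a nonzero ratio at which the secant step is defined. -/
def regularPairs (g : ℝ → ℝ) (n : ℕ) (δ : ℝ) : Set (ℝ × ℝ) :=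
  {p | p.1 ∈ Icc (-δ) δ ∧ p.2 ≠ 0 ∧ ratioDenom g n p ≠ 0}

theorem eventually_mem_regularPairs {g : ℝ → ℝ} (hg : ContinuousAt g 0) (h0 : g 0 ≠ 0) {δ : ℝ}
    (hδ : 0 < δ) {n : ℕ} {k : ℝ} (hk0 : k ≠ 0) (hk : k ^ n ≠ 1) :
    ∀ᶠ p in 𝓝 ((0 : ℝ), k), p ∈ regularPairs g n δ :=
  (continuousAt_fst.eventually (Icc_mem_nhds (by simpa using hδ) (by simpa using hδ))).and
    ((continuousAt_snd.eventually_ne hk0).and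
      ((continuousAt_ratioDenom hg n k).eventually_ne (ratioDenom_zero_ne_zero h0 hk)))

theorem secantSeq_eq_of_regular {f g : ℝ → ℝ} {n : ℕ} (hn : 1 ≤ n)
    (hfg : ∀ x, f x = x ^ n * g x) {δ : ℝ} {p : ℕ → ℝ × ℝ} (hp1 : (p 0).1 ≠ 0)
    (hp : ∀ i, p (i + 1) = ratioStep g n (p i)) (hreg : ∀ i, p i ∈ regularPairs g n δ) (i : ℕ) :
    secantSeq f (p 0).1 ((p 0).2 * (p 0).1) i = (p i).1 ∧
      secantSeq f (p 0).1 ((p 0).2 * (p 0).1) (i + 1) = (p i).2 * (p i).1 ∧ (p i).1 ≠ 0 := by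
  induction i with
  | zero => exact ⟨rfl, rfl, hp1⟩
  | succ i ih =>
    obtain ⟨e1, e2, e3⟩ := ih
    refine ⟨?_, ?_, ?_⟩
    · rw [e2, hp]; rfl
    · rw [secantSeq, e1, e2, hp, secant_step_eq hn hfg e3 (hreg i).2.2]
    · rw [hp]; exact mul_ne_zero (hreg i).2.1 e3

/-! ### Trapping and convergence of the true ratios -/

theorem exists_trapping {g : ℝ → ℝ} (hg : ContinuousAt g 0) (h0 : g 0 ≠ 0) {δ : ℝ}
    (hδ : 0 < δ) {m : ℕ} (hm : 1 ≤ m) :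
    ∃ η > 0, ∀ p : ℝ × ℝ, |p.1| < η → p.2 ∈ Icc (1 / 4) (trapBound (2 * m)) →
      p ∈ regularPairs g (2 * m) δ ∧ |(ratioStep g (2 * m) p).1| < η ∧
        (ratioStep g (2 * m) p).2 ∈ Icc (1 / 4) (trapBound (2 * m)) := by
  have hev : ∀ᶠ e in 𝓝 (0 : ℝ), ∀ k ∈ Icc (1 / 4) (trapBound (2 * m)),
      (e, k) ∈ regularPairs g (2 * m) δ ∧
        (ratioStep g (2 * m) (e, k)).2 ∈ Icc (1 / 4) (trapBound (2 * m)) := by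
    -- Compactness turns the local statement at each `(0, k)` into one neighbourhood of `0` serving
    -- all `k`.
    refine isCompact_Icc.eventually_forall_of_forall_eventually fun k hk => ?_
    have hk' := trap_subset hm hk
    have hN : k ^ (2 * m) ≠ 1 := (pow_lt_one₀ hk'.1.le hk'.2 (by omega)).ne
    refine (eventually_mem_regularPairs hg h0 hδ hk'.1.ne' hN).and ?_
    have hmem := ratioMap_mem_trap hm hk.1 hk'.2
    refine (continuousAt_ratioStep hg h0 hN).snd.eventually ?_
    beta_reduce
    rw [ratioStep_zero h0]
    exact Icc_mem_nhds hmem.1 hmem.2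
  obtain ⟨η, hη, h⟩ := Metric.eventually_nhds_iff.1 hev
  refine ⟨η, hη, fun p hp1 hp2 => ?_⟩
  obtain ⟨h1, h2⟩ := h (y := p.1) (by simpa using hp1) p.2 hp2
  refine ⟨h1, ?_, h2⟩
  have hk' := trap_subset hm hp2
  rw [ratioStep, abs_mul, abs_of_pos hk'.1]
  nlinarith [abs_nonneg p.1, hk'.2]

theorem tendsto_of_trapped {g : ℝ → ℝ} (hg : ContinuousAt g 0) (h0 : g 0 ≠ 0) {m : ℕ}
    (hm : 1 ≤ m) {p : ℕ → ℝ × ℝ} (hp : ∀ i, p (i + 1) = ratioStep g (2 * m) (p i))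
    (htrap : ∀ i, (p i).2 ∈ Icc (1 / 4) (trapBound (2 * m))) :
    Tendsto (fun i => (p i).1) atTop (𝓝 0) ∧
      ∃ c ∈ Ioo (0 : ℝ) 1, Tendsto (fun i => (p i).2) atTop (𝓝 c) := by
  have hr0 : 0 ≤ trapBound (2 * m) := by linarith [(htrap 0).1, (htrap 0).2]
  have hbound : ∀ i, |(p i).1| ≤ trapBound (2 * m) ^ i * |(p 0).1| := by
    intro i
    induction i with
    | zero => simp
    | succ i ih =>
      rw [hp, ratioStep, abs_mul, abs_of_pos (trap_subset hm (htrap i)).1, pow_succ', mul_assoc]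
      exact mul_le_mul (htrap i).2 ih (abs_nonneg _) hr0
  have he : Tendsto (fun i => (p i).1) atTop (𝓝 0) := by
    refine squeeze_zero_norm hbound ?_
    simpa using (tendsto_pow_atTop_nhds_zero_of_lt_one hr0 (trapBound_lt_one hm)).mul_const |(p 0).1|
  refine ⟨he, ?_⟩
  have hN : ∀ k ∈ Icc (1 / 4) (trapBound (2 * m)), k ^ (2 * m) ≠ 1 := fun k hk =>
    (pow_lt_one₀ (trap_subset hm hk).1.le (trap_subset hm hk).2 (by omega)).ne
  -- Since the errors vanish, uniform closeness of the step to `h_{2m}` over the compact interval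
  -- makes the ratios an asymptotic orbit.
  have hlim : Tendsto (fun i => (p (i + 1)).2 - ratioMap (2 * m) (p i).2) atTop (𝓝 0) := by
    rw [Metric.tendsto_atTop']
    intro ε hε
    have hev : ∀ᶠ e in 𝓝 (0 : ℝ), ∀ k ∈ Icc (1 / 4) (trapBound (2 * m)),
        |(ratioStep g (2 * m) (e, k)).2 - ratioMap (2 * m) k| < ε := by
      refine isCompact_Icc.eventually_forall_of_forall_eventually fun k hk => ?_
      have hc : ContinuousAt (fun q : ℝ × ℝ =>
          |(ratioStep g (2 * m) q).2 - ratioMap (2 * m) q.2|) (0, k) :=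
        ((continuousAt_ratioStep hg h0 (hN k hk)).snd.sub
          (ContinuousAt.comp_of_eq (continuousAt_ratioMap (hN k hk)) continuousAt_snd rfl)).abs
      refine hc.eventually (gt_mem_nhds ?_)
      simpa [ratioStep_zero h0] using hε
    obtain ⟨i₀, hi₀⟩ := eventually_atTop.1 (he.eventually hev)
    refine ⟨i₀, fun i hi => ?_⟩
    rw [Real.dist_eq, sub_zero, hp]
    exact hi₀ i hi.le _ (htrap i)
  obtain ⟨n, hn⟩ : ∃ n, 2 * m = n + 1 := ⟨2 * m - 1, by omega⟩
  obtain ⟨c, hc, hlim⟩ := exists_tendsto_of_antitoneOn (h := ratioMap (2 * m))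
    (by rw [hn]; exact (ratioMap_antitoneOn n).mono (hn ▸ trap_subset hm))
    (fun k hk => (continuousAt_ratioMap (hN k hk)).continuousWithinAt)
    (fun a ha b hb hab h1 h2 => by
      have ha' := trap_subset hm ha
      have hb' := trap_subset hm hb
      rw [hn] at h1 h2
      exact ratioMap_eq_of_le_of_le ha' hb' hab h1 h2)
    htrap hlim
  exact ⟨c, trap_subset hm hc, hlim⟩

/-! ### The main theorem -/

theorem theorem4p12 (m : ℕ) (hm : 1 ≤ m) (δ : ℝ) (hδ : 0 < δ) (f : ℝ → ℝ)
    (hf : ContDiffOn ℝ ((2 * m + 1 : ℕ) : WithTop ℕ∞) f (Icc (-δ) δ))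
    (hroot : HasFoldRootAtZero f (Icc (-δ) δ) (2 * m))
    (k₀ : ℝ)
    (hk : ∀ ℓ : ℕ, IsLeast {n : ℕ | modelRatio m k₀ n ∉ ratioSet m hm} ℓ →
      modelRatio m k₀ ℓ ∉ ({-1, 0, 1, charRootOne m hm, charRootTwo m hm} : Set ℝ)) :
    ∃ ε : ℝ, 0 < ε ∧ ∀ e₀ : ℝ, 0 < |e₀| → |e₀| < ε →
      (∀ n : ℕ, secantSeq f e₀ (k₀ * e₀) n ∈ Icc (-δ) δ ∧
        secantSeq f e₀ (k₀ * e₀) n ≠ 0 ∧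
        f (secantSeq f e₀ (k₀ * e₀) n) ≠ f (secantSeq f e₀ (k₀ * e₀) (n + 1))) ∧
      QLinearlyConvergesTo (secantSeq f e₀ (k₀ * e₀)) 0 := by
  obtain ⟨g, hg, h0, hfg⟩ := exists_eq_pow_mul hδ (n := 2 * m) (by omega)
    (hf.of_le (by exact_mod_cast Nat.le_succ _)) hroot
  obtain ⟨η, hη, htrap⟩ := exists_trapping hg h0 hδ hm
  obtain ⟨L, hL⟩ := exists_modelRatio_mem_trap hk
  have hne : ∀ n, modelRatio m k₀ n ≠ 0 ∧ modelRatio m k₀ n ^ (2 * m) ≠ 1 := fun n => by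
    have := modelRatio_notMem hk n
    simp only [mem_insert_iff, mem_singleton_iff, not_or] at this
    exact ⟨this.2.1, pow_two_mul_ne_one hm this.2.2 this.1⟩
  -- The pair after `n` steps as a function of the initial error: it is continuous at `0`, where its
  -- value is the model orbit. Only the first `L` steps need this continuity; afterwards the trap
  -- takes over.
  let P : ℕ → ℝ → ℝ × ℝ := fun n e => (ratioStep g (2 * m))^[n] (e, k₀)
  have hPsucc : ∀ n e, P (n + 1) e = ratioStep g (2 * m) (P n e) := fun n e =>
    Function.iterate_succ_apply' _ _ _
  have hP0 : ∀ n, P n 0 = (0, modelRatio m k₀ n) := by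
    intro n
    induction n with
    | zero => rfl
    | succ n ih => rw [hPsucc, ih, ratioStep_zero h0]; rfl
  have hPcont : ∀ n, ContinuousAt (P n) 0 := by
    intro n
    induction n with
    | zero => exact ContinuousAt.prodMk continuousAt_id continuousAt_const
    | succ n ih =>
      have h := ContinuousAt.comp_of_eq (continuousAt_ratioStep hg h0 (hne n).2) ih (hP0 n)
      exact h.congr (Eventually.of_forall fun e => (hPsucc n e).symm)
  have hev : ∀ᶠ e in 𝓝 (0 : ℝ), (∀ n ∈ Finset.range L, P n e ∈ regularPairs g (2 * m) δ) ∧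
      |(P L e).1| < η ∧ (P L e).2 ∈ Icc (1 / 4) (trapBound (2 * m)) := by
    refine ((Finset.eventually_all _).2 fun n _ => ?_).and (.and ?_ ?_)
    · have h := eventually_mem_regularPairs hg h0 hδ (hne n).1 (hne n).2
      rw [← hP0] at h
      exact (hPcont n).eventually h
    · exact (hPcont L).fst.abs.eventually (gt_mem_nhds (by simpa [hP0] using hη))
    · refine (hPcont L).snd.eventually (Icc_mem_nhds ?_ ?_)
      · beta_reduce; rw [hP0]; exact hL.1
      · beta_reduce; rw [hP0]; exact hL.2
  obtain ⟨ε, hε, h⟩ := Metric.eventually_nhds_iff.1 hev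
  refine ⟨ε, hε, fun e₀ he₀ he₀ε => ?_⟩
  obtain ⟨hreg, hL1, hL2⟩ := h (y := e₀) (by simpa using he₀ε)
  have hT : ∀ i, |(P (i + L) e₀).1| < η ∧ (P (i + L) e₀).2 ∈ Icc (1 / 4) (trapBound (2 * m)) := by
    intro i
    induction i with
    | zero => rw [zero_add]; exact ⟨hL1, hL2⟩
    | succ i ih => rw [add_right_comm, hPsucc]; exact (htrap _ ih.1 ih.2).2
  have hreg' : ∀ n, P n e₀ ∈ regularPairs g (2 * m) δ := by
    intro n
    rcases lt_or_ge n L with hn | hn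
    · exact hreg n (Finset.mem_range.2 hn)
    · obtain ⟨i, rfl⟩ := Nat.exists_eq_add_of_le' hn
      exact (htrap _ (hT i).1 (hT i).2).1
  have hsec : ∀ n, secantSeq f e₀ (k₀ * e₀) n = (P n e₀).1 ∧
      secantSeq f e₀ (k₀ * e₀) (n + 1) = (P n e₀).2 * (P n e₀).1 ∧ (P n e₀).1 ≠ 0 :=
    secantSeq_eq_of_regular (by omega) hfg (p := fun n => P n e₀) (abs_pos.1 he₀)
      (fun n => hPsucc n e₀) hreg'
  obtain ⟨hlim, c, hc, hlimc⟩ := tendsto_of_trapped hg h0 hm (p := fun i => P (i + L) e₀)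
    (fun i => by rw [add_right_comm, hPsucc]) (fun i => (hT i).2)
  refine ⟨fun n => ?_, ?_, c, hc.1, hc.2, ?_⟩
  · obtain ⟨e1, e2, e3⟩ := hsec n
    refine ⟨e1 ▸ (hreg' n).1, e1 ▸ e3, ?_⟩
    -- The difference of function values is `e_n ^ (2 * m)` times a denominator that is nonzero at
    -- regular pairs.
    rw [e1, e2, ← sub_ne_zero, sub_eq_pow_mul_ratioDenom hfg]
    exact mul_ne_zero (pow_ne_zero _ e3) (hreg' n).2.2
  · refine ((tendsto_add_atTop_iff_nat (f := fun n => (P n e₀).1) L).1 hlim).congr fun n => ?_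
    rw [(hsec n).1]
  · have h := ((tendsto_add_atTop_iff_nat (f := fun n => (P n e₀).2) L).1 hlimc).abs
    rw [abs_of_pos hc.1] at h
    refine h.congr fun n => ?_
    obtain ⟨e1, e2, e3⟩ := hsec n
    rw [e1, e2, sub_zero, sub_zero, abs_mul, mul_div_cancel_right₀ _ (abs_ne_zero.2 e3)]

end
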